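/- Let $D_0$ be a pointed dcpo (a partial order in which every directed set has a supremum and which has a least element), and let $(\varphi_0,\psi_0)$ be any embedding-projection pair from $D_0$ to $[D_0\to D_0]$: both maps are Scott-continuous, $\psi_0\circ\varphi_0=\mathrm{id}$ and $\varphi_0\circ\psi_0\le\mathrm{id}$ (Scott's pair $\varphi_0(d)=\lambda x.\,d$, $\psi_0(f)=f(\bot)$ is an example). Here $[D\to E]$ is the pointwise ordered dcpo of Scott-continuous maps. Put $D_{n+1}=[D_n\to D_n]$, $\varphi_{n+1}(f)=\varphi_n\circ f\circ\psi_n$, $\psi_{n+1}(g)=\psi_n\circ g\circ\varphi_n$, and let $$D_\infty=\{(a_n)_n \mid a_n\in D_n,\ \psi_n(a_{n+1})=a_n\text{ for all }n\}$$ with the coordinatewise order, with approximants $a\mapsto a_n\in D_n$, with the canonical embeddings $\iota_n:D_n\to D_\infty$, with application $a\cdot b=\bigsqcup_n\iota_n(a_{n+1}(b_n))$, and with abstraction $\mathrm{abs}(f)=\bigsqcup_n\iota_{n+1}\big(z\mapsto (f(\iota_n z))_n\big)$ for Scott-continuous $f:D_\infty\to D_\infty$. Simple types are built from one base type $o$ by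 $\to$. For every simple type $\sigma$ let $D_\sigma=D_\infty$ and define $d_\sigma:D_\sigma\times D_\sigma\to\mathbb{R}_{\ge 0}$ by induction on $\sigma$: $d_o(a,b)=0$ if $a=b$ and $1$ otherwise; $d_{\sigma\to\tau}(a,b)=2^{-m}$, where $m$ is the maximum of the set $S$ of all $n\in\mathbb{N}$ such that 1. $a_n=b_n$, and 2. for all $c,e\in D_\sigma$, if $d_\sigma(c,e)\le 2^{-n}$ then $d_\tau(a\cdot c,\,b\cdot e)\le 2^{-n}$; if $S$ is unbounded then $d_{\sigma\to\tau}(a,b)=0$, and if $S$ is empty then $d_{\sigma\to\tau}(a,b)=1$. Let $\mathcal D=(D,\cdot,\Lambda,d)$ be the structure in which, for each finite word $w=i_1\cdots i_k$ of types and each type $j$, $\Lambda_{w,j}$ sends a closed simply typed $\lambda$-term of type $w\to j=i_1\to\cdots\to i_k\to j$ (possibly with elements of $D$ as constants) to its interpretation in $D_\infty$, where $[\![\lambda x.t]\!]_\rho=\mathrm{abs}(c\mapsto[\![t]\!]_{\rho[x\mapsto c]})$. **Claim.** For all $\sigma,\tau$, $(D_\sigma,d_\sigma)$ is a partial ultrametric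 space, i.e. $d(x,y)=d(y,x)$, $d(x,y)\le\max\{d(x,z),d(z,y)\}$ and $d(x,x),d(y,y)\le d(x,y)$; application is non-expansive, i.e. $d_\tau(a\cdot c,b\cdot e)\le\max\{d_{\sigma\to\tau}(a,b),d_\sigma(c,e)\}$; and $\mathcal D$ is a partial quantitative extensional $\lambda$-algebra. The last notion means the following. Give $D_w=D_{i_1}\times\cdots\times D_{i_k}$ the maximum distance $d_w$ (which is $0$ on the empty product). Let $\mathrm{Met}(w;j)$ be the set of the non-expansive functions $f:D_w\to D_j$ such that some closed term $t$ of type $w\to j$ (possibly with constants in $D$) *represents* $f$, i.e. $f(\vec a)=\Lambda_{w,j}(t)\cdot a_1\cdots a_k$ for all $\vec a\in D_w$. Give $\mathrm{Met}(w;j)$ the distance $$\Xi(f,g)=\inf\{\delta\in[0,\infty] \mid \forall \vec x,\vec y\in D_w,\ d_j(f(\vec x),g(\vec y))\le\max\{\delta,d_w(\vec x,\vec y)\}\}.$$ Then: * all $d_\sigma$ are partial ultrametrics and application is non-expansive; * the sets $\mathrm{Met}(w;j)$ form a cartesian multicategory: they contain the projections and are closed under composition; * for all $w,i,j$ the maps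 $\boldsymbol\Lambda:\mathrm{Met}(w*i;j)\to\mathrm{Met}(w;i\to j)$, $\boldsymbol\Lambda(f)(\vec a)=\Lambda_{w*i,j}(t)\cdot\vec a$ for any $t$ that represents $f$, and $\mathbf{Ev}:\mathrm{Met}(w;i\to j)\to\mathrm{Met}(w*i;j)$, $\mathbf{Ev}(g)(\vec a,b)=g(\vec a)\cdot b$, are well defined, mutually inverse, natural in $w$, and non-expansive for the distances $\Xi$. -/

import Mathlib

/-! ## Scott-continuous maps between pointed dcpos

A pointed dcpo is a `CompletePartialOrder`: every directed set has a supremum, and the empty set is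
directed, so there is a least element. -/

universe u

namespace ScottModel

/-- The set `[D → E]` of Scott-continuous maps. -/
structure SMap (D E : Type u) [CompletePartialOrder D] [CompletePartialOrder E] : Type u where
  toFun : D → E
  cont : ScottContinuous toFun

namespace SMap

variable {D E F : Type u} [CompletePartialOrder D] [CompletePartialOrder E]
  [CompletePartialOrder F]

instance : CoeFun (SMap D E) (fun _ => D → E) := ⟨toFun⟩

theorem ext {f g : SMap D E} (h : ∀ x, f x = g x) : f = g := by
  cases f; cases g; congr; exact funext h

theorem mono (f : SMap D E) : Monotone (f : D → E) := f.cont.monotone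

/-- The pointwise order. -/
instance : PartialOrder (SMap D E) :=
  PartialOrder.lift toFun fun _ _ h => ext fun x => congrFun h x

theorem le_def {f g : SMap D E} : f ≤ g ↔ ∀ x, f x ≤ g x := Iff.rfl

theorem directedOn_eval {S : Set (SMap D E)} (hS : DirectedOn (· ≤ ·) S) (x : D) :
    DirectedOn (· ≤ ·) ((fun f : SMap D E => f x) '' S) := by
  rintro _ ⟨f, hf, rfl⟩ _ ⟨g, hg, rfl⟩
  obtain ⟨h, hh, h1, h2⟩ := hS f hf g hg
  exact ⟨_, ⟨h, hh, rfl⟩, h1 x, h2 x⟩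

theorem scottContinuous_pointwise_sSup {S : Set (SMap D E)} (hS : DirectedOn (· ≤ ·) S) :
    ScottContinuous (fun x => sSup ((fun f : SMap D E => f x) '' S)) := by
  intro d hd hdir a ha
  constructor
  · rintro _ ⟨x, hx, rfl⟩
    refine (directedOn_eval hS x).sSup_le ?_
    rintro _ ⟨f, hf, rfl⟩
    exact (f.mono (ha.1 hx)).trans ((directedOn_eval hS a).le_sSup ⟨f, hf, rfl⟩)
  · intro b hb
    refine (directedOn_eval hS a).sSup_le ?_
    rintro _ ⟨f, hf, rfl⟩
    refine (f.cont hd hdir ha).2 ?_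
    rintro _ ⟨x, hx, rfl⟩
    exact ((directedOn_eval hS x).le_sSup ⟨f, hf, rfl⟩).trans (hb ⟨x, hx, rfl⟩)

open Classical in
/-- The supremum of a directed set of continuous maps is taken pointwise. -/
noncomputable instance : SupSet (SMap D E) where
  sSup S := if hS : DirectedOn (· ≤ ·) S then
      ⟨fun x => sSup ((fun f : SMap D E => f x) '' S), scottContinuous_pointwise_sSup hS⟩
    else ⟨fun _ => ⊥, ScottContinuous.const _⟩

open Classical in
theorem sSup_apply {S : Set (SMap D E)} (hS : DirectedOn (· ≤ ·) S) (x : D) :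
    sSup S x = sSup ((fun f : SMap D E => f x) '' S) := by
  change (dite _ _ _ : SMap D E) x = _
  rw [dif_pos hS]

/-- `[D → E]` is again a pointed dcpo. -/
noncomputable instance : CompletePartialOrder (SMap D E) :=
  CompletePartialOrder.ofLubOfDirected _ fun S hS => by
    constructor
    · intro f hf x
      change f x ≤ sSup S x
      rw [sSup_apply hS]
      exact (directedOn_eval hS x).le_sSup ⟨f, hf, rfl⟩
    · intro g hg x
      change sSup S x ≤ g x
      rw [sSup_apply hS]
      refine (directedOn_eval hS x).sSup_le ?_
      rintro _ ⟨f, hf, rfl⟩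
      exact hg hf x

/-- The identity map. -/
def id : SMap D D := ⟨fun x => x, ScottContinuous.id⟩

/-- Composition `g ∘ f`. -/
def comp (g : SMap E F) (f : SMap D E) : SMap D F :=
  ⟨fun x => g (f x), ScottContinuous.comp f.cont g.cont⟩

theorem eval_isLUB {S : Set (SMap D E)} (hS : DirectedOn (· ≤ ·) S) {g : SMap D E}
    (hg : IsLUB S g) (x : D) : IsLUB ((fun f : SMap D E => f x) '' S) (g x) := by
  rw [hg.unique hS.isLUB_sSup, sSup_apply hS]
  exact (directedOn_eval hS x).isLUB_sSup

end SMap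

section Continuity

variable {X : Type*} [Preorder X] {D E F : Type u} [CompletePartialOrder D]
  [CompletePartialOrder E] [CompletePartialOrder F]

theorem directedOn_image {f : X → D} (hf : Monotone f) {d : Set X} (hd : DirectedOn (· ≤ ·) d) :
    DirectedOn (· ≤ ·) (f '' d) := by
  rintro _ ⟨x, hx, rfl⟩ _ ⟨y, hy, rfl⟩
  obtain ⟨z, hz, h1, h2⟩ := hd x hx y hy
  exact ⟨_, ⟨z, hz, rfl⟩, hf h1, hf h2⟩

/-- A map into `[D → E]` is continuous if it is so pointwise. -/
theorem scottContinuous_toSMap {h : X → SMap D E} (hh : ∀ x, ScottContinuous fun e => h e x) :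
    ScottContinuous h := by
  intro d hd hdir a ha
  constructor
  · rintro _ ⟨e, he, rfl⟩ x
    exact (hh x).monotone (ha.1 he)
  · intro g hg x
    refine (hh x hd hdir ha).2 ?_
    rintro _ ⟨e, he, rfl⟩
    exact hg ⟨e, he, rfl⟩ x

/-- Evaluation is jointly continuous. -/
theorem scottContinuous_eval {h : X → SMap D E} {g : X → D} (hh : ScottContinuous h)
    (hg : ScottContinuous g) : ScottContinuous fun e => h e (g e) := by
  intro d hd hdir a ha
  constructor
  · rintro _ ⟨e, he, rfl⟩
    exact ((h e).mono (hg.monotone (ha.1 he))).trans (hh.monotone (ha.1 he) (g a))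
  · intro b hb
    refine ((h a).cont (hd.image g) (directedOn_image hg.monotone hdir) (hg hd hdir ha)).2 ?_
    rintro _ ⟨_, ⟨e, he, rfl⟩, rfl⟩
    refine (SMap.eval_isLUB (directedOn_image hh.monotone hdir) (hh hd hdir ha) (g e)).2 ?_
    rintro _ ⟨_, ⟨e', he', rfl⟩, rfl⟩
    obtain ⟨c, hc, h1, h2⟩ := hdir e he e' he'
    exact ((hh.monotone h2 (g e)).trans ((h c).mono (hg.monotone h1))).trans (hb ⟨c, hc, rfl⟩)

/-- The supremum of an increasing sequence of continuous maps is continuous. -/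
theorem scottContinuous_iSup {f : ℕ → X → D} (hf : ∀ n, ScottContinuous (f n))
    (hm : ∀ e, Monotone fun n => f n e) : ScottContinuous fun e => ⨆ n, f n e := by
  intro d hd hdir a ha
  constructor
  · rintro _ ⟨e, he, rfl⟩
    refine Directed.iSup_le (hm e).directed_le fun n => ?_
    exact ((hf n).monotone (ha.1 he)).trans (Directed.le_iSup (hm a).directed_le n)
  · intro b hb
    refine Directed.iSup_le (hm a).directed_le fun n => ?_
    refine (hf n hd hdir ha).2 ?_
    rintro _ ⟨e, he, rfl⟩
    exact (Directed.le_iSup (hm e).directed_le n).trans (hb ⟨e, he, rfl⟩)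

end Continuity

/-! ## Scott's inverse limit -/

/-- An embedding-projection pair from `D` to `E`: continuous maps `emb : D → E` and
`proj : E → D` with `proj ∘ emb = id` and `emb ∘ proj ≤ id`. -/
structure EPPair (D E : Type u) [CompletePartialOrder D] [CompletePartialOrder E] where
  emb : SMap D E
  proj : SMap E D
  proj_emb : ∀ x, proj (emb x) = x
  emb_proj : ∀ y, emb (proj y) ≤ y

/-- The induced pair from `[D → D]` to `[E → E]`, namely `f ↦ emb ∘ f ∘ proj` and
`g ↦ proj ∘ g ∘ emb`. -/
noncomputable def EPPair.lift {D E : Type u} [CompletePartialOrder D] [CompletePartialOrder E]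
    (P : EPPair D E) : EPPair (SMap D D) (SMap E E) where
  emb := ⟨fun f => P.emb.comp (f.comp P.proj), scottContinuous_toSMap fun y =>
    ScottContinuous.comp (f := fun f : SMap D D => f (P.proj y))
      (scottContinuous_eval ScottContinuous.id (ScottContinuous.const _)) P.emb.cont⟩
  proj := ⟨fun g => P.proj.comp (g.comp P.emb), scottContinuous_toSMap fun x =>
    ScottContinuous.comp (f := fun g : SMap E E => g (P.emb x))
      (scottContinuous_eval ScottContinuous.id (ScottContinuous.const _)) P.proj.cont⟩
  proj_emb f := SMap.ext fun x => by
    change P.proj (P.emb (f (P.proj (P.emb x)))) = f x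
    rw [P.proj_emb, P.proj_emb]
  emb_proj g y := by
    change P.emb (P.proj (g (P.emb (P.proj y)))) ≤ g y
    exact (P.emb_proj _).trans (g.mono (P.emb_proj y))

/-- A bundled pointed dcpo. -/
structure Cpo where
  carrier : Type u
  str : CompletePartialOrder carrier

attribute [instance] Cpo.str

/-- The sequence `D₀`, `D_{n+1} = [D_n → D_n]`, with its structure. -/
noncomputable def tower (D₀ : Type u) [CompletePartialOrder D₀] : ℕ → Cpo.{u}
  | 0 => ⟨D₀, inferInstance⟩
  | n + 1 => ⟨SMap (tower D₀ n).carrier (tower D₀ n).carrier, inferInstance⟩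

/-- The domain `D_n`. -/
abbrev Dn (D₀ : Type u) [CompletePartialOrder D₀] (n : ℕ) : Type u := (tower D₀ n).carrier

section Limit

variable {D₀ : Type u} [CompletePartialOrder D₀] (P : EPPair D₀ (SMap D₀ D₀))

/-- The embedding-projection pair from `D_n` to `D_{n+1}`: the given one for `n = 0`, then lifted. -/
noncomputable def ep : ∀ n, EPPair (Dn D₀ n) (Dn D₀ (n + 1))
  | 0 => P
  | n + 1 => (ep n).lift

/-- The inverse limit `D_∞`: sequences `(x_n)` with `x_n ∈ D_n` and `proj (x_{n+1}) = x_n`. -/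
structure DInf : Type u where
  /-- The `n`-th approximant `x_n` of `x`: its projection into `D_n`. -/
  coord : ∀ n, Dn D₀ n
  proj_coord : ∀ n, (ep P n).proj (coord (n + 1)) = coord n

variable {P}

namespace DInf

theorem ext {x y : DInf P} (h : ∀ n, x.coord n = y.coord n) : x = y := by
  cases x; cases y; congr; exact funext h

/-- The coordinatewise order. -/
noncomputable instance : PartialOrder (DInf P) :=
  PartialOrder.lift coord fun _ _ h => ext fun n => congrFun h n

theorem le_def {x y : DInf P} : x ≤ y ↔ ∀ n, x.coord n ≤ y.coord n := Iff.rfl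

theorem directedOn_coord {S : Set (DInf P)} (hS : DirectedOn (· ≤ ·) S) (n : ℕ) :
    DirectedOn (· ≤ ·) ((fun x : DInf P => x.coord n) '' S) :=
  directedOn_image (f := fun x : DInf P => x.coord n) (fun _ _ h => le_def.1 h n) hS

theorem proj_sSup_coord {S : Set (DInf P)} (hne : S.Nonempty) (hS : DirectedOn (· ≤ ·) S) (n : ℕ) :
    (ep P n).proj (sSup ((fun x : DInf P => x.coord (n + 1)) '' S)) =
      sSup ((fun x : DInf P => x.coord n) '' S) := by
  have h := (ep P n).proj.cont (hne.image _) (directedOn_coord hS (n + 1))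
    (directedOn_coord hS (n + 1)).isLUB_sSup
  rw [Set.image_image] at h
  simp only [proj_coord] at h
  exact h.unique (directedOn_coord hS n).isLUB_sSup

theorem proj_bot (n : ℕ) : (ep P n).proj ⊥ = ⊥ :=
  le_bot_iff.1 <| ((ep P n).proj.mono bot_le).trans ((ep P n).proj_emb ⊥).le

open Classical in
/-- The supremum of a directed set is taken coordinatewise. -/
noncomputable instance : SupSet (DInf P) where
  sSup S := if hS : S.Nonempty ∧ DirectedOn (· ≤ ·) S then
      ⟨fun n => sSup ((fun x : DInf P => x.coord n) '' S), proj_sSup_coord hS.1 hS.2⟩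
    else ⟨fun _ => ⊥, proj_bot⟩

open Classical in
theorem sSup_coord {S : Set (DInf P)} (hne : S.Nonempty) (hS : DirectedOn (· ≤ ·) S) (n : ℕ) :
    (sSup S).coord n = sSup ((fun x : DInf P => x.coord n) '' S) := by
  change (dite _ _ _ : DInf P).coord n = _
  rw [dif_pos ⟨hne, hS⟩]

open Classical in
/-- `D_∞` is a pointed dcpo. -/
noncomputable instance : CompletePartialOrder (DInf P) :=
  CompletePartialOrder.ofLubOfDirected _ fun S hS => by
    rcases S.eq_empty_or_nonempty with rfl | hne
    · rw [isLUB_empty_iff]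
      intro x n
      change (dite _ _ _ : DInf P).coord n ≤ x.coord n
      rw [dif_neg fun h => Set.not_nonempty_empty h.1]
      exact bot_le
    · constructor
      · intro x hx n
        change x.coord n ≤ (sSup S).coord n
        rw [sSup_coord hne hS]
        exact (directedOn_coord hS n).le_sSup ⟨x, hx, rfl⟩
      · intro y hy n
        change (sSup S).coord n ≤ y.coord n
        rw [sSup_coord hne hS]
        refine (directedOn_coord hS n).sSup_le ?_
        rintro _ ⟨x, hx, rfl⟩
        exact hy hx n

theorem scottContinuous_coord (n : ℕ) : ScottContinuous fun x : DInf P => x.coord n := by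
  intro d hd hdir a ha
  rw [ha.unique hdir.isLUB_sSup]
  change IsLUB _ ((sSup d).coord n)
  rw [sSup_coord hd hdir]
  exact (directedOn_coord hdir n).isLUB_sSup

theorem scottContinuous_of_coord {X : Type*} [Preorder X] {f : X → DInf P}
    (hf : ∀ n, ScottContinuous fun e => (f e).coord n) : ScottContinuous f := by
  intro d hd hdir a ha
  constructor
  · rintro _ ⟨e, he, rfl⟩ n
    exact (hf n).monotone (ha.1 he)
  · intro g hg n
    refine (hf n hd hdir ha).2 ?_
    rintro _ ⟨e, he, rfl⟩
    exact hg ⟨e, he, rfl⟩ n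

end DInf

variable (P)

open Classical in
/-- The canonical map `D_n → D_k`: a composite of embeddings if `n ≤ k`, of projections if `k < n`. -/
noncomputable def gap (n k : ℕ) : SMap (Dn D₀ n) (Dn D₀ k) :=
  if h : n ≤ k then
    Nat.leRecOn (C := fun m => SMap (Dn D₀ n) (Dn D₀ m)) h (fun {m} f => (ep P m).emb.comp f) SMap.id
  else
    Nat.decreasingInduction (motive := fun m _ => SMap (Dn D₀ n) (Dn D₀ m))
      (fun m _ f => (ep P m).proj.comp f) SMap.id (Nat.le_of_not_le h)

theorem gap_self (n : ℕ) : gap P n n = SMap.id := by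
  simp [gap, Nat.leRecOn_self]

theorem gap_succ {n k : ℕ} (h : n ≤ k) : gap P n (k + 1) = (ep P k).emb.comp (gap P n k) := by
  rw [gap, gap, dif_pos h, dif_pos (Nat.le_succ_of_le h), Nat.leRecOn_succ h]

theorem gap_of_lt {n k : ℕ} (h : k < n) : gap P n k = (ep P k).proj.comp (gap P n (k + 1)) := by
  rw [gap, dif_neg (Nat.not_le.2 h), Nat.decreasingInduction_succ_left _ _ h]
  rcases Nat.lt_or_ge (k + 1) n with h' | h'
  · rw [gap, dif_neg (Nat.not_le.2 h')]
  · obtain rfl : k + 1 = n := le_antisymm h h'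
    rw [gap_self, Nat.decreasingInduction_self]

theorem proj_gap (n k : ℕ) (x : Dn D₀ n) : (ep P k).proj (gap P n (k + 1) x) = gap P n k x := by
  rcases Nat.lt_or_ge k n with h | h
  · rw [gap_of_lt P h]; rfl
  · rw [gap_succ P h]; exact (ep P k).proj_emb _

/-- The embedding `D_n → D_∞`. -/
noncomputable def inj (n : ℕ) : SMap (Dn D₀ n) (DInf P) :=
  ⟨fun x => ⟨fun k => gap P n k x, fun k => proj_gap P n k x⟩,
    DInf.scottContinuous_of_coord fun k => (gap P n k).cont⟩

theorem gap_emb (n k : ℕ) (x : Dn D₀ n) :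
    gap P (n + 1) k ((ep P n).emb x) = gap P n k x := by
  rcases Nat.lt_or_ge n k with h | h
  · induction k, h using Nat.le_induction with
    | base => rw [gap_self, gap_succ P le_rfl, gap_self]; rfl
    | succ k hk ih =>
      rw [gap_succ P hk, gap_succ P (Nat.le_of_succ_le hk)]
      exact congrArg _ ih
  · induction h using Nat.decreasingInduction with
    | self => rw [gap_of_lt P n.lt_succ_self, gap_self, gap_self]; exact (ep P n).proj_emb x
    | of_succ k hk ih =>
      rw [gap_of_lt P (Nat.lt_succ_of_lt hk), gap_of_lt P hk]
      exact congrArg _ ih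

theorem inj_emb (n : ℕ) (x : Dn D₀ n) : inj P (n + 1) ((ep P n).emb x) = inj P n x :=
  DInf.ext fun k => gap_emb P n k x

theorem inj_proj_le (n : ℕ) (x : Dn D₀ (n + 1)) :
    inj P n ((ep P n).proj x) ≤ inj P (n + 1) x := by
  rw [← inj_emb]
  exact (inj P (n + 1)).mono ((ep P n).emb_proj x)

variable {P}

namespace DInf

/-- `x_{n+1}`, an element of `D_{n+1} = [D_n → D_n]`, as a map. -/
def coordFun (x : DInf P) (n : ℕ) : SMap (Dn D₀ n) (Dn D₀ n) := x.coord (n + 1)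

/-- Application on `D_∞`: `x · y` is the supremum of the increasing sequence of the
`x_{n+1}(y_n)`, embedded into `D_∞`. -/
noncomputable def app (x y : DInf P) : DInf P := ⨆ n, inj P n (x.coordFun n (y.coord n))

theorem coordFun_eq (x : DInf P) (n : ℕ) (z : Dn D₀ n) :
    x.coordFun n z = (ep P n).proj (x.coordFun (n + 1) ((ep P n).emb z)) := by
  have h : (ep P n).lift.proj (x.coordFun (n + 1)) = x.coordFun n := x.proj_coord (n + 1)
  conv_lhs => rw [← h]
  rfl

theorem app_chain (x y : DInf P) :
    Monotone fun n => inj P n (x.coordFun n (y.coord n)) := by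
  refine monotone_nat_of_le_succ fun n => ?_
  rw [coordFun_eq]
  refine (inj_proj_le P n _).trans ((inj P (n + 1)).mono ((x.coordFun (n + 1)).mono ?_))
  rw [← proj_coord]
  exact (ep P n).emb_proj _

theorem scottContinuous_app {X : Type*} [Preorder X] {f g : X → DInf P} (hf : ScottContinuous f)
    (hg : ScottContinuous g) : ScottContinuous fun e => (f e).app (g e) := by
  refine scottContinuous_iSup (fun n => ?_) fun e => app_chain (f e) (g e)
  refine ScottContinuous.comp ?_ (inj P n).cont
  refine scottContinuous_eval (h := fun e => (f e).coordFun n) ?_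
    (ScottContinuous.comp hg (scottContinuous_coord n))
  exact ScottContinuous.comp hf (scottContinuous_coord (n + 1))

/-- The `n`-th approximation in `[D_n → D_n]` of a continuous map on `D_∞`: embed into `D_∞`,
apply `f`, project to `D_n`. -/
noncomputable def restrict (f : SMap (DInf P) (DInf P)) (n : ℕ) : SMap (Dn D₀ n) (Dn D₀ n) :=
  ⟨fun z => (f (inj P n z)).coord n,
    ScottContinuous.comp (ScottContinuous.comp (inj P n).cont f.cont) (scottContinuous_coord n)⟩

/-- The element of `D_∞` that represents a continuous map `f` on `D_∞`: the supremum of the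
increasing sequence of the approximations of `f` in `D_{n+1} = [D_n → D_n]`. -/
noncomputable def abs (f : SMap (DInf P) (DInf P)) : DInf P := ⨆ n, inj P (n + 1) (restrict f n)

theorem abs_chain (f : SMap (DInf P) (DInf P)) :
    Monotone fun n => inj P (n + 1) (restrict f n) := by
  refine monotone_nat_of_le_succ fun n => ?_
  refine (inj_emb P (n + 1) (restrict f n)).symm.le.trans ((inj P (n + 1 + 1)).mono ?_)
  intro z
  change (ep P n).emb ((f (inj P n ((ep P n).proj z))).coord n) ≤
    (f (inj P (n + 1) z)).coord (n + 1)
  rw [← proj_coord]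
  exact ((ep P n).emb_proj _).trans (f.mono (inj_proj_le P n z) (n + 1))

theorem scottContinuous_abs {X : Type*} [Preorder X] {f : X → SMap (DInf P) (DInf P)}
    (hf : ∀ x, ScottContinuous fun e => f e x) : ScottContinuous fun e => abs (f e) := by
  refine scottContinuous_iSup (fun n => ?_) fun e => abs_chain (f e)
  refine ScottContinuous.comp ?_ (inj P (n + 1)).cont
  exact scottContinuous_toSMap (h := fun e => restrict (f e) n) fun z =>
    ScottContinuous.comp (hf _) (scottContinuous_coord n)

end DInf

end Limit

/-! ## Simple types and typed λ-terms -/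

/-- Simple types over one base type `o`. -/
inductive Ty : Type
  | o : Ty
  | arrow : Ty → Ty → Ty

infixr:60 " ⇒ " => Ty.arrow

/-- Finite lists of types, and the type `w → j`. Lists grow at the head: `i :: w` is the word
`w * i`, whose last letter is `i`, so that `(w * i) → j` is `w → (i → j)`. -/
def arrows : List Ty → Ty → Ty
  | [], j => j
  | i :: w, j => arrows w (i ⇒ j)

/-- Simply typed λ-terms with constants from the sorted set `A`. The variables of type `i` are the
pairs `(i, n)` with `n : ℕ`; `lam i n t` is `λx.t` for the variable `x = (i, n)`. -/
inductive Term (A : Ty → Type u) : Ty → Type u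
  | var (i : Ty) (n : ℕ) : Term A i
  | const {i : Ty} (a : A i) : Term A i
  | app {i j : Ty} (t : Term A (i ⇒ j)) (s : Term A i) : Term A j
  | lam (i : Ty) (n : ℕ) {j : Ty} (t : Term A j) : Term A (i ⇒ j)

/-- The free variables of a term. -/
def Term.fv {A : Ty → Type u} : ∀ {j : Ty}, Term A j → Set (Ty × ℕ)
  | _, .var i n => {(i, n)}
  | _, .const _ => ∅
  | _, .app t s => t.fv ∪ s.fv
  | _, .lam i n t => t.fv \ {(i, n)}

/-- Closed terms of type `j`. -/
def ClosedTerm (A : Ty → Type u) (j : Ty) : Type u := {t : Term A j // t.fv = ∅}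

/-! ## Partial ultrametrics -/

open scoped ENNReal

/-- `(X, d)` is a partial ultrametric space. -/
structure IsPartialUltraMetric {X : Type*} (d : X → X → ℝ≥0∞) : Prop where
  symm : ∀ x y, d x y = d y x
  trans : ∀ x y z, d x y ≤ max (d x z) (d z y)
  refl_left : ∀ x y, d x x ≤ d x y
  refl_right : ∀ x y, d y y ≤ d x y

/-- `f : (X, a) → (Y, b)` is non-expansive. -/
def NonExpansive {X Y : Type*} (a : X → X → ℝ≥0∞) (b : Y → Y → ℝ≥0∞) (f : X → Y) : Prop :=
  ∀ x y, b (f x) (f y) ≤ a x y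

/-- The distance of a binary product. -/
noncomputable def prodDist {X Y : Type*} (a : X → X → ℝ≥0∞) (b : Y → Y → ℝ≥0∞)
    (p q : X × Y) : ℝ≥0∞ :=
  max (a p.1 q.1) (b p.2 q.2)

/-- `Ξ_{a,b}(f, g)`, the infimum of all `δ` such that `b (f x) (g y) ≤ max δ (a x y)` for all
`x, y`. -/
noncomputable def xiDist {X Y : Type*} (a : X → X → ℝ≥0∞) (b : Y → Y → ℝ≥0∞)
    (f g : X → Y) : ℝ≥0∞ :=
  sInf {δ | ∀ x y, b (f x) (g y) ≤ max δ (a x y)}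

/-! ## Partial quantitative extensional λ-algebras -/

/-- The data of a partial quantitative applicative λ-algebra over simple types, without its laws:
sorts, application, a choice of an element for every closed term (with constants in the algebra) of
type `w → j`, and a distance on every sort. -/
structure LambdaStructure where
  carrier : Ty → Type u
  app : ∀ {i j : Ty}, carrier (i ⇒ j) → carrier i → carrier j
  Lam : ∀ (w : List Ty) (j : Ty), ClosedTerm carrier (arrows w j) → carrier (arrows w j)
  dist : ∀ i : Ty, carrier i → carrier i → ℝ≥0∞

namespace LambdaStructure

variable (𝒜 : LambdaStructure.{u})

/-- The product `A_w`; here `A_{w * i} = A_w × A_i`. -/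
def Tuple : List Ty → Type u
  | [] => PUnit
  | i :: w => Tuple w × 𝒜.carrier i

/-- The product distance on `A_w` (the maximum; `0` on the empty product). -/
noncomputable def tupleDist : ∀ w : List Ty, 𝒜.Tuple w → 𝒜.Tuple w → ℝ≥0∞
  | [] => fun _ _ => 0
  | i :: w => prodDist (tupleDist w) (𝒜.dist i)

/-- Iterated application `g · a₁ · … · a_k` of `g ∈ A_{w → j}` to a tuple in `A_w`. -/
def appTuple : ∀ (w : List Ty) {j : Ty}, 𝒜.carrier (arrows w j) → 𝒜.Tuple w → 𝒜.carrier j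
  | [], _, g, _ => g
  | i :: w, j, g, a => 𝒜.app (appTuple w (j := i ⇒ j) g a.1) a.2

/-- The closed term `t` of type `w → j` represents the function `f : A_w → A_j`. -/
def Represents {w : List Ty} {j : Ty} (t : ClosedTerm 𝒜.carrier (arrows w j))
    (f : 𝒜.Tuple w → 𝒜.carrier j) : Prop :=
  ∀ a, f a = 𝒜.appTuple w (𝒜.Lam w j t) a

/-- The multi-arrows from `w` to `j`: non-expansive functions that some closed term represents. -/
def IsMultiArrow (w : List Ty) (j : Ty) (f : 𝒜.Tuple w → 𝒜.carrier j) : Prop :=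
  NonExpansive (𝒜.tupleDist w) (𝒜.dist j) f ∧
    ∃ t : ClosedTerm 𝒜.carrier (arrows w j), 𝒜.Represents t f

/-- The set of multi-arrows from `w` to `j`. -/
def MultiArrow (w : List Ty) (j : Ty) : Type u :=
  {f : 𝒜.Tuple w → 𝒜.carrier j // 𝒜.IsMultiArrow w j f}

/-- The distance `Ξ` on multi-arrows. -/
noncomputable def arrowDist {w : List Ty} {j : Ty} (f g : 𝒜.MultiArrow w j) : ℝ≥0∞ :=
  xiDist (𝒜.tupleDist w) (𝒜.dist j) f.1 g.1

/-- A map `A_v → A_w` all of whose components are multi-arrows. -/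
def IsTupleArrow (v : List Ty) : ∀ w : List Ty, (𝒜.Tuple v → 𝒜.Tuple w) → Prop
  | [], _ => True
  | i :: w, h => IsTupleArrow v w (fun a => (h a).1) ∧ 𝒜.IsMultiArrow v i (fun a => (h a).2)

/-- The distances are partial ultrametrics and application is non-expansive. -/
structure IsPartialQuantitativeApplicative : Prop where
  partialUltraMetric : ∀ i, IsPartialUltraMetric (𝒜.dist i)
  app_nonExpansive : ∀ i j, NonExpansive (prodDist (𝒜.dist (i ⇒ j)) (𝒜.dist i)) (𝒜.dist j)
    (fun p : 𝒜.carrier (i ⇒ j) × 𝒜.carrier i => 𝒜.app p.1 p.2)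

/-- The multi-arrows form a cartesian multicategory: they contain the projections (the components
of the identity of `A_w`) and are closed under composition. -/
structure IsMulticategory : Prop where
  proj : ∀ w, 𝒜.IsTupleArrow w w (fun a => a)
  comp : ∀ (v w : List Ty) (j : Ty) (h : 𝒜.Tuple v → 𝒜.Tuple w) (f : 𝒜.Tuple w → 𝒜.carrier j),
    𝒜.IsTupleArrow v w h → 𝒜.IsMultiArrow w j f → 𝒜.IsMultiArrow v j (fun a => f (h a))

/-- `Φ` is the family of the abstraction maps from the multi-arrows `w * i → j` to the multi-arrows
`w → (i → j)`: whatever closed term `t` represents `f`, the value of `Φ f` at `a` is the chosen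
element for `t`, applied to `a`. -/
def IsAbstraction
    (Φ : ∀ (w : List Ty) (i j : Ty), 𝒜.MultiArrow (i :: w) j → 𝒜.MultiArrow w (i ⇒ j)) : Prop :=
  ∀ (w : List Ty) (i j : Ty) (f : 𝒜.MultiArrow (i :: w) j)
    (t : ClosedTerm 𝒜.carrier (arrows (i :: w) j)), 𝒜.Represents t f.1 →
    ∀ a, (Φ w i j f).1 a = 𝒜.appTuple w (j := i ⇒ j) (𝒜.Lam (i :: w) j t) a

/-- `Ψ` is the family of the evaluation maps from the multi-arrows `w → (i → j)` to the multi-arrows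
`w * i → j`, given by `Ψ g (a, b) = g a · b`. -/
def IsEvaluation
    (Ψ : ∀ (w : List Ty) (i j : Ty), 𝒜.MultiArrow w (i ⇒ j) → 𝒜.MultiArrow (i :: w) j) : Prop :=
  ∀ (w : List Ty) (i j : Ty) (g : 𝒜.MultiArrow w (i ⇒ j)) (a : 𝒜.Tuple w) (b : 𝒜.carrier i),
    (Ψ w i j g).1 (a, b) = 𝒜.app (g.1 a) b

/-- Naturality in `w` of a family of maps from the multi-arrows `w * i → j` to the multi-arrows
`w → (i → j)`: the image of `f ∘ (h × id)` is the image of `f`, composed with `h`. -/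
def IsNatural
    (Φ : ∀ (w : List Ty) (i j : Ty), 𝒜.MultiArrow (i :: w) j → 𝒜.MultiArrow w (i ⇒ j)) : Prop :=
  ∀ (v w : List Ty) (i j : Ty) (h : 𝒜.Tuple v → 𝒜.Tuple w), 𝒜.IsTupleArrow v w h →
    ∀ (f : 𝒜.MultiArrow (i :: w) j) (f' : 𝒜.MultiArrow (i :: v) j),
      (∀ a b, f'.1 (a, b) = f.1 (h a, b)) → ∀ a, (Φ v i j f').1 a = (Φ w i j f).1 (h a)

/-- Naturality in `w` of a family of maps in the other direction. -/
def IsNaturalInv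
    (Ψ : ∀ (w : List Ty) (i j : Ty), 𝒜.MultiArrow w (i ⇒ j) → 𝒜.MultiArrow (i :: w) j) : Prop :=
  ∀ (v w : List Ty) (i j : Ty) (h : 𝒜.Tuple v → 𝒜.Tuple w), 𝒜.IsTupleArrow v w h →
    ∀ (g : 𝒜.MultiArrow w (i ⇒ j)) (g' : 𝒜.MultiArrow v (i ⇒ j)),
      (∀ a, g'.1 a = g.1 (h a)) → ∀ a b, (Ψ v i j g').1 (a, b) = (Ψ w i j g).1 (h a, b)

/-- Partial quantitative extensional λ-algebras: abstraction and evaluation are well defined,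
mutually inverse, natural, and non-expansive for the distances `Ξ`. -/
structure IsPartialQuantitativeExtensionalLambdaAlgebra : Prop where
  applicative : 𝒜.IsPartialQuantitativeApplicative
  multicategory : 𝒜.IsMulticategory
  iso : ∃ (Φ : ∀ (w : List Ty) (i j : Ty), 𝒜.MultiArrow (i :: w) j → 𝒜.MultiArrow w (i ⇒ j))
      (Ψ : ∀ (w : List Ty) (i j : Ty), 𝒜.MultiArrow w (i ⇒ j) → 𝒜.MultiArrow (i :: w) j),
    𝒜.IsAbstraction Φ ∧ 𝒜.IsEvaluation Ψ ∧
    (∀ w i j, Function.LeftInverse (Ψ w i j) (Φ w i j)) ∧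
    (∀ w i j, Function.RightInverse (Ψ w i j) (Φ w i j)) ∧
    𝒜.IsNatural Φ ∧ 𝒜.IsNaturalInv Ψ ∧
    (∀ w i j, NonExpansive 𝒜.arrowDist 𝒜.arrowDist (Φ w i j)) ∧
    (∀ w i j, NonExpansive 𝒜.arrowDist 𝒜.arrowDist (Ψ w i j))

end LambdaStructure

/-! ## The algebra of `D_∞` -/

section Model

variable {D₀ : Type u} [CompletePartialOrder D₀] (P : EPPair D₀ (SMap D₀ D₀))

/-- Environments: every variable `(i, n)` is assigned an element of `D_i = D_∞`. -/
abbrev Env : Type u := Ty → ℕ → DInf P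

variable {P}

open Classical in
/-- The environment `ρ[(i, n) ↦ d]`. -/
noncomputable def Env.update (ρ : Env P) (i : Ty) (n : ℕ) (d : DInf P) : Env P :=
  fun i' n' => if i' = i ∧ n' = n then d else ρ i' n'

theorem scottContinuous_pi {X : Type*} [Preorder X] {f : X → Env P}
    (hf : ∀ i n, ScottContinuous fun e => f e i n) : ScottContinuous f := by
  intro d hd hdir a ha
  constructor
  · rintro _ ⟨e, he, rfl⟩ i n
    exact (hf i n).monotone (ha.1 he)
  · intro g hg i n
    refine (hf i n hd hdir ha).2 ?_
    rintro _ ⟨e, he, rfl⟩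
    exact hg ⟨e, he, rfl⟩ i n

theorem scottContinuous_lookup (i : Ty) (n : ℕ) : ScottContinuous fun ρ : Env P => ρ i n := by
  intro d _ _ a ha
  have h := isLUB_pi.1 (isLUB_pi.1 ha i) n
  rwa [Set.image_image] at h

theorem scottContinuous_update_right (ρ : Env P) (i : Ty) (n : ℕ) :
    ScottContinuous fun d => ρ.update i n d := by
  refine scottContinuous_pi fun i' n' => ?_
  unfold Env.update
  split_ifs
  · exact ScottContinuous.id
  · exact ScottContinuous.const _

theorem scottContinuous_update_left (i : Ty) (n : ℕ) (d : DInf P) :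
    ScottContinuous fun ρ : Env P => ρ.update i n d := by
  refine scottContinuous_pi fun i' n' => ?_
  unfold Env.update
  split_ifs
  · exact ScottContinuous.const _
  · exact scottContinuous_lookup i' n'

/-- The interpretation of λ-terms in `D_∞`, as a continuous function of the environment, with the
clause `⟦λx.t⟧ρ = abs (d ↦ ⟦t⟧ρ[x ↦ d])`. -/
noncomputable def interp : ∀ {j : Ty}, Term (fun _ => DInf P) j →
    {F : Env P → DInf P // ScottContinuous F}
  | _, .var i n => ⟨fun ρ => ρ i n, scottContinuous_lookup i n⟩
  | _, .const a => ⟨fun _ => a, ScottContinuous.const a⟩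
  | _, .app t s => ⟨fun ρ => ((interp t).1 ρ).app ((interp s).1 ρ),
      DInf.scottContinuous_app (interp t).2 (interp s).2⟩
  | _, .lam i n t =>
      ⟨fun ρ => DInf.abs ⟨fun d => (interp t).1 (ρ.update i n d),
          ScottContinuous.comp (scottContinuous_update_right ρ i n) (interp t).2⟩,
        DInf.scottContinuous_abs fun d =>
          ScottContinuous.comp (scottContinuous_update_left i n d) (interp t).2⟩

variable (P)

open Classical in
/-- `2^{-m}` for the maximum `m` of `S`; `0` if `S` is unbounded, and `1` if `S` is empty. -/
noncomputable def levelDist (S : Set ℕ) : ℝ≥0∞ :=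
  if S = ∅ then 1 else if h : ∃ m, IsGreatest S m then (1 / 2) ^ h.choose else 0

open Classical in
/-- The distance on `D_σ = D_∞`. -/
noncomputable def distD : Ty → DInf P → DInf P → ℝ≥0∞
  | .o => fun a b => if a = b then 0 else 1
  | .arrow σ τ => fun a b => levelDist {n | a.coord n = b.coord n ∧
      ∀ c d, distD σ c d ≤ (1 / 2) ^ n → distD τ (a.app c) (b.app d) ≤ (1 / 2) ^ n}

/-- The structure `𝒟`: the set `D_∞` at every type, with its application, the interpretation of
closed terms (the environment is irrelevant) and the distances. -/
noncomputable def algebraD : LambdaStructure.{u} where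
  carrier := fun _ => DInf P
  app := DInf.app
  Lam := fun _ _ t => (interp t.1).1 (fun _ _ => ⊥)
  dist := distD P

end Model

end ScottModel

/-!
The proof rests on two facts: `D_∞` is an extensional combinatory algebra, and every distance `d_σ`
is the discrete metric.

For the first, the approximants of an element form a chain with that element as its supremum
(`DInf.iSup_inj_coord`), and the approximants of `abs f` are the restrictions of `f`
(`DInf.coordFun_abs`). Continuity of `f` then gives `abs f · b = f b` (`DInf.app_abs`). Conversely
`a_{n+1}(z)` is the `n`-th approximant of `a · ι_n z` (`DInf.coord_app_inj`), so `a` is determined by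
the map `c ↦ a · c` (`DInf.ext_app`). Nothing about the initial embedding-projection pair is used
beyond its laws.

For the second, `d_o` is discrete by definition. If `d_σ` and `d_τ` are discrete, then for `n ≥ 1`
the condition that `d_σ(c,e) ≤ 2⁻ⁿ` implies `d_τ(a · c, b · e) ≤ 2⁻ⁿ` says that `a · c = b · c` for
all `c`, that is, `a = b`. Hence all `n` are levels of `(a, a)`, and at most `0` is a level of
`(a, b)` if `a ≠ b` (`distD_eq_ite`). The ultrametric laws follow, and all functions between the
products `D_w` are non-expansive.

The multi-arrows `D_w → D_j` are therefore exactly the functions `a ↦ u · a₁ · … · a_k` with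
`u ∈ D_∞` (`LambdaStructure.isMultiArrow_iff`). They contain the constants and the projections and
are closed under pointwise application because of the combinators `K` and `S`, and this gives
closure under composition. Abstraction and evaluation keep the representing element `u`; that they
are well defined, mutually inverse and natural is extensionality once more. Abstraction is
non-expansive for `Ξ` because two distinct elements of `D_{i → j}` differ at some argument, and
evaluation is so because application is.
-/

namespace ScottModel

section Limit

variable {D₀ : Type u} [CompletePartialOrder D₀] {P : EPPair D₀ (SMap D₀ D₀)}

namespace DInf

/-! ### Approximants -/

theorem gap_coord (x : DInf P) {k n : ℕ} (h : k ≤ n) : gap P n k (x.coord n) = x.coord k := by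
  induction h using Nat.decreasingInduction with
  | self => rw [gap_self]; rfl
  | of_succ k hk ih => rw [gap_of_lt P hk, ← x.proj_coord k, ← ih]; rfl

theorem gap_proj {k m : ℕ} (h : k ≤ m) (w : Dn D₀ (m + 1)) :
    gap P (m + 1) k w = gap P m k ((ep P m).proj w) := by
  have h₁ := gap_coord (inj P (m + 1) w) h
  have h₂ : (inj P (m + 1) w).coord m = (ep P m).proj w := by
    change gap P (m + 1) m w = _
    rw [gap_of_lt P m.lt_succ_self, gap_self]; rfl
  rw [h₂] at h₁
  exact h₁.symm

/-- The `k`-th approximant of the supremum of a chain is read off from any tail on which the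
`k`-th approximants are constant. -/
theorem coord_iSup_of_eventually_eq {s : ℕ → DInf P} (hs : Monotone s) {k N : ℕ} {c : Dn D₀ k}
    (h : ∀ n, N ≤ n → (s n).coord k = c) : (⨆ n, s n).coord k = c := by
  have hd : DirectedOn (· ≤ ·) (Set.range s) := directedOn_range.2 hs.directed_le
  have h₁ := scottContinuous_coord k (Set.range_nonempty s) hd hd.isLUB_sSup
  refine h₁.unique ⟨?_, ?_⟩
  · rintro _ ⟨_, ⟨n, rfl⟩, rfl⟩
    rw [← h _ (le_max_right n N)]
    exact hs (le_max_left n N) k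
  · intro b hb
    rw [← h N le_rfl]
    exact hb ⟨_, ⟨N, rfl⟩, rfl⟩

theorem inj_coord_mono (x : DInf P) : Monotone fun n => inj P n (x.coord n) := by
  refine monotone_nat_of_le_succ fun n => ?_
  rw [← x.proj_coord n]
  exact inj_proj_le P n _

theorem iSup_inj_coord (x : DInf P) : ⨆ n, inj P n (x.coord n) = x :=
  ext fun k => coord_iSup_of_eventually_eq x.inj_coord_mono (N := k) fun _ hn => x.gap_coord hn

theorem inj_coord_le (x : DInf P) (n : ℕ) : inj P n (x.coord n) ≤ x := by
  conv_rhs => rw [← x.iSup_inj_coord]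
  exact Directed.le_iSup x.inj_coord_mono.directed_le n

/-! ### Application and abstraction are mutually inverse -/

theorem restrict_succ (f : SMap (DInf P) (DInf P)) (n : ℕ) :
    (ep P (n + 1)).proj (restrict f (n + 1)) = restrict f n := by
  refine SMap.ext fun z => ?_
  change (ep P n).proj ((f (inj P (n + 1) ((ep P n).emb z))).coord (n + 1)) = (f (inj P n z)).coord n
  rw [inj_emb, proj_coord]

theorem gap_restrict (f : SMap (DInf P) (DInf P)) {k n : ℕ} (h : k ≤ n) :
    gap P (n + 1) (k + 1) (restrict f n) = restrict f k := by
  induction n, h using Nat.le_induction with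
  | base => rw [gap_self]; rfl
  | succ n hn ih =>
    refine (gap_proj (Nat.succ_le_succ hn) _).trans ?_
    rw [restrict_succ, ih]

theorem coordFun_abs (f : SMap (DInf P) (DInf P)) (k : ℕ) : (abs f).coordFun k = restrict f k :=
  coord_iSup_of_eventually_eq (abs_chain f) (N := k) fun _ hn => gap_restrict f hn

/-- The β-law. -/
theorem app_abs (f : SMap (DInf P) (DInf P)) (b : DInf P) : (abs f).app b = f b := by
  have hm := app_chain (abs f) b
  have hval : ∀ n, inj P n ((abs f).coordFun n (b.coord n)) =
      inj P n ((f (inj P n (b.coord n))).coord n) := fun n => by rw [coordFun_abs]; rfl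
  apply le_antisymm
  · refine Directed.iSup_le hm.directed_le fun n => ?_
    rw [hval]
    exact (inj_coord_le _ n).trans (f.mono (b.inj_coord_le n))
  · have hd : DirectedOn (· ≤ ·) (Set.range fun n => inj P n (b.coord n)) :=
      directedOn_range.2 b.inj_coord_mono.directed_le
    have hb : IsLUB (Set.range fun n => inj P n (b.coord n)) b := by
      have h := hd.isLUB_sSup
      rwa [show sSup (Set.range fun n => inj P n (b.coord n)) = b from b.iSup_inj_coord] at h
    refine (f.cont (Set.range_nonempty _) hd hb).2 ?_
    rintro _ ⟨_, ⟨m, rfl⟩, rfl⟩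
    change f (inj P m (b.coord m)) ≤ _
    rw [← iSup_inj_coord (f (inj P m (b.coord m)))]
    refine Directed.iSup_le (inj_coord_mono _).directed_le fun k => ?_
    -- Both indices are raised to their maximum, which picks a term of the diagonal sequence.
    refine ((inj_coord_mono _) (le_max_right m k)).trans (le_trans ?_
      (Directed.le_iSup hm.directed_le (max m k)))
    simp only [hval]
    exact (inj P _).mono (f.mono (b.inj_coord_mono (le_max_left m k)) _)

theorem gap_coordFun_gap (a : DInf P) {n m : ℕ} (h : n ≤ m) (z : Dn D₀ n) :
    gap P m n (a.coordFun m (gap P n m z)) = a.coordFun n z := by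
  induction m, h using Nat.le_induction with
  | base => rw [gap_self]; rfl
  | succ m hm ih =>
    rw [gap_proj hm, gap_succ P hm, ← ih, a.coordFun_eq m]
    rfl

theorem coord_app_inj (a : DInf P) (n : ℕ) (z : Dn D₀ n) :
    (a.app (inj P n z)).coord n = a.coordFun n z :=
  coord_iSup_of_eventually_eq (app_chain a _) (N := n) fun _ hm => gap_coordFun_gap a hm z

/-- Extensionality of `D_∞`, equivalent to the η-law. -/
theorem ext_app {a b : DInf P} (h : ∀ c, a.app c = b.app c) : a = b := by
  have hs : ∀ n, a.coord (n + 1) = b.coord (n + 1) := fun n => SMap.ext fun z => by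
    change a.coordFun n z = b.coordFun n z
    rw [← coord_app_inj, ← coord_app_inj, h]
  exact ext fun n => by rw [← a.proj_coord n, ← b.proj_coord n, hs n]

/-! ### The combinators -/

theorem exists_combinator_K : ∃ K : DInf P, ∀ x y, (K.app x).app y = x := by
  refine ⟨(interp (.lam .o 0 (.lam .o 1 (.var .o 0)))).1 (fun _ _ => ⊥), fun x y => ?_⟩
  simp [interp, app_abs, Env.update]

theorem exists_combinator_S :
    ∃ S : DInf P, ∀ x y z, ((S.app x).app y).app z = (x.app z).app (y.app z) := by
  refine ⟨(interp (.lam (.o ⇒ .o ⇒ .o) 0 (.lam (.o ⇒ .o) 0 (.lam .o 0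
    (.app (.app (.var (.o ⇒ .o ⇒ .o) 0) (.var .o 0)) (.app (.var (.o ⇒ .o) 0) (.var .o 0))))))).1
      (fun _ _ => ⊥), fun x y z => ?_⟩
  simp [interp, app_abs, Env.update]

end DInf

end Limit

/-! ### The distances are discrete -/

open scoped ENNReal

section Model

variable {D₀ : Type u} [CompletePartialOrder D₀] {P : EPPair D₀ (SMap D₀ D₀)}

open Classical in
theorem levelDist_eq_ite {S : Set ℕ} {p : Prop} (h₁ : p → S = Set.univ) (h₀ : ¬p → S ⊆ {0}) :
    levelDist S = if p then 0 else 1 := by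
  unfold levelDist
  by_cases hp : p
  · have hS := h₁ hp
    rw [if_pos hp, if_neg (by simp [hS]), dif_neg]
    rintro ⟨m, hm⟩
    have := hm.2 (show m + 1 ∈ S by simp [hS])
    omega
  · rw [if_neg hp]
    split_ifs with he hm
    · rfl
    · rw [h₀ hp hm.choose_spec.1, pow_zero]
    · rcases Set.subset_singleton_iff_eq.1 (h₀ hp) with h | h
      · exact absurd h he
      · exact absurd ⟨0, by rw [h]; exact isGreatest_singleton⟩ hm

theorem half_pow_lt_one {n : ℕ} (hn : n ≠ 0) : (1 / 2 : ℝ≥0∞) ^ n < 1 :=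
  pow_lt_one₀ zero_le (by rw [one_div]; exact ENNReal.inv_lt_one.2 (by norm_num)) hn

open Classical in
/-- Every `d_σ` is the discrete metric. For `n ≥ 1` the bound `d ≤ 2⁻ⁿ < 1` means equality, by
induction, so that `n` is a level of `(a, b)` only if `a · c = b · c` for all `c`, that is, by
extensionality, only if `a = b`. -/
theorem distD_eq_ite (σ : Ty) (a b : DInf P) : distD P σ a b = if a = b then 0 else 1 := by
  induction σ generalizing a b with
  | o => rfl
  | arrow σ τ ihσ ihτ =>
    have hle : ∀ {n : ℕ} {x y : DInf P}, n ≠ 0 →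
        ((if x = y then (0 : ℝ≥0∞) else 1) ≤ (1 / 2) ^ n ↔ x = y) := fun {n x y} hn => by
      by_cases h : x = y
      · simp [h]
      · simp [h, -one_div, half_pow_lt_one hn]
    refine levelDist_eq_ite ?_ ?_
    · rintro rfl
      refine Set.eq_univ_of_forall fun n => ⟨rfl, fun c d hcd => ?_⟩
      rw [ihσ] at hcd
      rw [ihτ]
      rcases eq_or_ne n 0 with rfl | hn
      · split_ifs <;> simp
      · rw [hle hn] at hcd ⊢
        rw [hcd]
    · intro hab n hn
      by_contra hn0
      refine hab (DInf.ext_app fun c => ?_)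
      have := hn.2 c c (by simp [ihσ])
      rwa [ihτ, hle hn0] at this

theorem distD_self (σ : Ty) (a : DInf P) : distD P σ a a = 0 := by simp [distD_eq_ite]

theorem distD_of_ne (σ : Ty) {a b : DInf P} (h : a ≠ b) : distD P σ a b = 1 := by
  simp [distD_eq_ite, h]

theorem distD_le_one (σ : Ty) (a b : DInf P) : distD P σ a b ≤ 1 := by
  rw [distD_eq_ite]; split_ifs <;> simp

theorem isPartialUltraMetric_distD (σ : Ty) : IsPartialUltraMetric (distD P σ) where
  symm x y := by
    by_cases h : x = y
    · rw [h]
    · rw [distD_of_ne σ h, distD_of_ne σ (Ne.symm h)]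
  trans x y z := by
    by_cases h : x = z
    · rw [h]; exact le_max_right _ _
    · rw [distD_of_ne σ h]; exact (distD_le_one σ x y).trans (le_max_left _ _)
  refl_left x y := by simp [distD_self]
  refl_right x y := by simp [distD_self]

theorem nonExpansive_app (σ τ : Ty) :
    NonExpansive (prodDist (distD P (σ ⇒ τ)) (distD P σ)) (distD P τ)
      (fun p : DInf P × DInf P => p.1.app p.2) := by
  rintro ⟨a, c⟩ ⟨b, e⟩
  by_cases h : a = b
  · by_cases h' : c = e
    · simp [h, h', distD_self]
    · exact (distD_le_one τ _ _).trans ((distD_of_ne σ h').ge.trans (le_max_right _ _))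
  · exact (distD_le_one τ _ _).trans ((distD_of_ne (σ ⇒ τ) h).ge.trans (le_max_left _ _))

/-! ### Representable functions -/

namespace LambdaStructure

theorem tupleDist_self (w : List Ty) (a : (algebraD P).Tuple w) :
    (algebraD P).tupleDist w a a = 0 := by
  induction w with
  | nil => rfl
  | cons i w ih =>
    change max ((algebraD P).tupleDist w a.1 a.1) (distD P i a.2 a.2) = 0
    rw [ih, max_eq_right zero_le]
    exact distD_self i _

theorem one_le_tupleDist (w : List Ty) {a b : (algebraD P).Tuple w} (h : a ≠ b) :
    1 ≤ (algebraD P).tupleDist w a b := by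
  induction w with
  | nil => exact absurd rfl h
  | cons i w ih =>
    by_cases h₁ : a.1 = b.1
    · have h₂ : a.2 ≠ b.2 := fun h₂ => h (Prod.ext h₁ h₂)
      exact (distD_of_ne i h₂).ge.trans (le_max_right _ _)
    · exact (ih h₁).trans (le_max_left _ _)

/-- Every function on `D_w` is non-expansive, since the distances are discrete. -/
theorem nonExpansive_algebraD (w : List Ty) (j : Ty)
    (f : (algebraD P).Tuple w → (algebraD P).carrier j) :
    NonExpansive ((algebraD P).tupleDist w) ((algebraD P).dist j) f := by
  intro x y
  by_cases h : x = y
  · rw [h]; exact (distD_self j (f y)).trans_le zero_le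
  · exact (distD_le_one j _ _).trans (one_le_tupleDist w h)

/-- Since closed terms may contain constants, the multi-arrows of `𝒟` are the functions
`a ↦ u · a₁ · … · a_k` with `u ∈ D_∞`. -/
theorem isMultiArrow_iff {w : List Ty} {j : Ty} {f : (algebraD P).Tuple w → DInf P} :
    (algebraD P).IsMultiArrow w j f ↔
      ∃ u : DInf P, ∀ a, f a = (algebraD P).appTuple w (j := j) u a :=
  ⟨fun ⟨_, _, ht⟩ => ⟨_, ht⟩,
    fun ⟨u, hu⟩ => ⟨nonExpansive_algebraD w j f, ⟨.const u, rfl⟩, hu⟩⟩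

theorem isMultiArrow_const (w : List Ty) (j : Ty) (u : DInf P) :
    (algebraD P).IsMultiArrow w j fun _ => u := by
  obtain ⟨K, hK⟩ := DInf.exists_combinator_K (P := P)
  induction w generalizing j u with
  | nil => exact isMultiArrow_iff.2 ⟨u, fun _ => rfl⟩
  | cons i w ih =>
    obtain ⟨v, hv⟩ := isMultiArrow_iff.1 (ih (i ⇒ j) (K.app u))
    refine isMultiArrow_iff.2 ⟨v, fun a => ?_⟩
    exact (hK u a.2).symm.trans (congrArg (DInf.app · a.2) (hv a.1))

/-- Multi-arrows are closed under pointwise application: the last argument is distributed by the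
combinator `S`, and the induction goes on with the remaining arguments. -/
theorem isMultiArrow_app {w : List Ty} {i j : Ty} {f g : (algebraD P).Tuple w → DInf P}
    (hf : (algebraD P).IsMultiArrow w (i ⇒ j) f) (hg : (algebraD P).IsMultiArrow w i g) :
    (algebraD P).IsMultiArrow w j fun a => (f a).app (g a) := by
  obtain ⟨S, hS⟩ := DInf.exists_combinator_S (P := P)
  induction w generalizing i j with
  | nil =>
    obtain ⟨u, hu⟩ := isMultiArrow_iff.1 hf
    obtain ⟨v, hv⟩ := isMultiArrow_iff.1 hg
    exact isMultiArrow_iff.2 ⟨u.app v, fun a => by rw [hu, hv]; rfl⟩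
  | cons k w ih =>
    obtain ⟨u, hu⟩ := isMultiArrow_iff.1 hf
    obtain ⟨v, hv⟩ := isMultiArrow_iff.1 hg
    have hu' : (algebraD P).IsMultiArrow w (k ⇒ i ⇒ j) _ := isMultiArrow_iff.2 ⟨u, fun _ => rfl⟩
    have hv' : (algebraD P).IsMultiArrow w (k ⇒ i) _ := isMultiArrow_iff.2 ⟨v, fun _ => rfl⟩
    have hSu := ih (j := (k ⇒ i) ⇒ k ⇒ j) (isMultiArrow_const w _ S) hu'
    obtain ⟨x, hx⟩ := isMultiArrow_iff.1 (ih hSu hv')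
    refine isMultiArrow_iff.2 ⟨x, fun a => ?_⟩
    rw [hu, hv]
    exact (hS _ _ a.2).symm.trans (congrArg (DInf.app · a.2) (hx a.1))

theorem isMultiArrow_weaken {w : List Ty} (i : Ty) {j : Ty} {f : (algebraD P).Tuple w → DInf P}
    (hf : (algebraD P).IsMultiArrow w j f) :
    (algebraD P).IsMultiArrow (i :: w) j fun a => f a.1 := by
  obtain ⟨K, hK⟩ := DInf.exists_combinator_K (P := P)
  obtain ⟨u, hu⟩ := isMultiArrow_iff.1
    (isMultiArrow_app (j := i ⇒ j) (isMultiArrow_const w (j ⇒ i ⇒ j) K) hf)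
  refine isMultiArrow_iff.2 ⟨u, fun a => ?_⟩
  exact (hK (f a.1) a.2).symm.trans (congrArg (DInf.app · a.2) (hu a.1))

theorem isTupleArrow_weaken {v : List Ty} (i : Ty) (w : List Ty)
    {h : (algebraD P).Tuple v → (algebraD P).Tuple w} (hh : (algebraD P).IsTupleArrow v w h) :
    (algebraD P).IsTupleArrow (i :: v) w fun a => h a.1 := by
  induction w with
  | nil => trivial
  | cons k w ih => exact ⟨ih hh.1, isMultiArrow_weaken i hh.2⟩

theorem isMultiArrow_last (w : List Ty) (i : Ty) :
    (algebraD P).IsMultiArrow (i :: w) i fun a => a.2 := by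
  obtain ⟨K, hK⟩ := DInf.exists_combinator_K (P := P)
  obtain ⟨S, hS⟩ := DInf.exists_combinator_S (P := P)
  -- `S K K` is the identity.
  obtain ⟨u, hu⟩ := isMultiArrow_iff.1 (isMultiArrow_const w (i ⇒ i) ((S.app K).app K))
  refine isMultiArrow_iff.2 ⟨u, fun a => ?_⟩
  have h : ((S.app K).app K).app a.2 = a.2 := (hS _ _ _).trans (hK _ _)
  exact h.symm.trans (congrArg (DInf.app · a.2) (hu a.1))

theorem isMulticategory_algebraD : (algebraD P).IsMulticategory where
  proj w := by
    induction w with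
    | nil => trivial
    | cons i w ih => exact ⟨isTupleArrow_weaken i w ih, isMultiArrow_last w i⟩
  comp v w j h f hh hf := by
    obtain ⟨u, hu⟩ := isMultiArrow_iff.1 hf
    simp only [hu]
    clear hu hf f
    induction w generalizing j u with
    | nil => exact isMultiArrow_const v j u
    | cons i w ih => exact isMultiArrow_app (ih (i ⇒ j) _ hh.1 u) hh.2

/-! ### Abstraction and evaluation -/

theorem exists_curry {w : List Ty} {i j : Ty} (f : (algebraD P).MultiArrow (i :: w) j) :
    ∃ g : (algebraD P).MultiArrow w (i ⇒ j), ∀ a (b : DInf P), DInf.app (g.1 a) b = f.1 (a, b) := by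
  obtain ⟨u, hu⟩ := isMultiArrow_iff.1 f.2
  exact ⟨⟨_, isMultiArrow_iff.2 ⟨u, fun _ => rfl⟩⟩, fun a b => (hu (a, b)).symm⟩

/-- The abstraction map, characterized by `curry f a · b = f (a, b)`. -/
noncomputable def curry {w : List Ty} {i j : Ty} (f : (algebraD P).MultiArrow (i :: w) j) :
    (algebraD P).MultiArrow w (i ⇒ j) :=
  (exists_curry f).choose

theorem curry_app {w : List Ty} {i j : Ty} (f : (algebraD P).MultiArrow (i :: w) j)
    (a : (algebraD P).Tuple w) (b : DInf P) : DInf.app ((curry f).1 a) b = f.1 (a, b) :=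
  (exists_curry f).choose_spec a b

/-- The evaluation map `g ↦ ((a, b) ↦ g a · b)`. -/
noncomputable def uncurry {w : List Ty} {i j : Ty} (g : (algebraD P).MultiArrow w (i ⇒ j)) :
    (algebraD P).MultiArrow (i :: w) j :=
  ⟨fun p => DInf.app (g.1 p.1) p.2,
    isMultiArrow_app (isMultiArrow_weaken i g.2) (isMultiArrow_last w i)⟩

theorem arrowDist_curry_le {w : List Ty} {i j : Ty} :
    NonExpansive (algebraD P).arrowDist (algebraD P).arrowDist
      (curry : (algebraD P).MultiArrow (i :: w) j → (algebraD P).MultiArrow w (i ⇒ j)) := by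
  intro f g
  refine sInf_le_sInf fun δ hδ x y => ?_
  by_cases hxy : x = y
  · subst hxy
    by_cases h : (curry f).1 x = (curry g).1 x
    · rw [h]; exact (distD_self (i ⇒ j) _).trans_le zero_le
    · -- Two distinct values differ at some argument `b`, which forces `1 ≤ δ`.
      obtain ⟨b, hb⟩ : ∃ b : DInf P, f.1 (x, b) ≠ g.1 (x, b) := by
        by_contra! hc
        exact h (DInf.ext_app fun b => by rw [curry_app, curry_app, hc])
      have h₁ := hδ (x, b) (x, b)
      rw [tupleDist_self (i :: w) (x, b)] at h₁
      refine (distD_le_one (i ⇒ j) _ _).trans (((distD_of_ne j hb).ge.trans h₁).trans ?_)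
      exact max_le_max le_rfl zero_le
  · exact (distD_le_one (i ⇒ j) _ _).trans ((one_le_tupleDist w hxy).trans (le_max_right _ _))

theorem arrowDist_uncurry_le {w : List Ty} {i j : Ty} :
    NonExpansive (algebraD P).arrowDist (algebraD P).arrowDist
      (uncurry : (algebraD P).MultiArrow w (i ⇒ j) → (algebraD P).MultiArrow (i :: w) j) := by
  intro f g
  refine sInf_le_sInf fun δ hδ x y => ?_
  refine (nonExpansive_app i j (f.1 x.1, x.2) (g.1 y.1, y.2)).trans ?_
  change max _ _ ≤ max δ (max ((algebraD P).tupleDist w x.1 y.1) (distD P i x.2 y.2))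
  rw [← max_assoc]
  exact max_le_max (hδ x.1 y.1) le_rfl

theorem isPartialQuantitativeExtensionalLambdaAlgebra_algebraD :
    (algebraD P).IsPartialQuantitativeExtensionalLambdaAlgebra where
  applicative := ⟨isPartialUltraMetric_distD, nonExpansive_app⟩
  multicategory := isMulticategory_algebraD
  iso := by
    refine ⟨fun _ _ _ => curry, fun _ _ _ => uncurry, ?_, fun _ _ _ _ _ _ => rfl, ?_, ?_, ?_, ?_,
      fun _ _ _ => arrowDist_curry_le, fun _ _ _ => arrowDist_uncurry_le⟩
    · exact fun w i j f t ht a =>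
        DInf.ext_app fun b => (curry_app f a b).trans (ht (a, b))
    · exact fun w i j f => Subtype.ext (funext fun p => curry_app f p.1 p.2)
    · exact fun w i j g => Subtype.ext (funext fun a =>
        DInf.ext_app fun b => curry_app (uncurry g) a b)
    · intro v w i j h _ f f' hf a
      refine DInf.ext_app fun b => ?_
      rw [curry_app, curry_app]
      exact hf a b
    · intro v w i j h _ g g' hg a b
      exact congrArg (DInf.app · b) (hg a)

end LambdaStructure

end Model

end ScottModel

theorem mainTheorem10 {D₀ : Type*} [CompletePartialOrder D₀]
    (P : ScottModel.EPPair D₀ (ScottModel.SMap D₀ D₀)) :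
    (∀ σ : ScottModel.Ty, ScottModel.IsPartialUltraMetric (ScottModel.distD P σ)) ∧
    (∀ σ τ : ScottModel.Ty,
      ScottModel.NonExpansive
        (ScottModel.prodDist (ScottModel.distD P (ScottModel.Ty.arrow σ τ)) (ScottModel.distD P σ))
        (ScottModel.distD P τ)
        (fun p : ScottModel.DInf P × ScottModel.DInf P => p.1.app p.2)) ∧
    (ScottModel.algebraD P).IsPartialQuantitativeExtensionalLambdaAlgebra := by
  exact ⟨ScottModel.isPartialUltraMetric_distD, ScottModel.nonExpansive_app,
    ScottModel.LambdaStructure.isPartialQuantitativeExtensionalLambdaAlgebra_algebraD⟩
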